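/- Let $k\ge 2$ and let $\mathcal{H}$ be a finite $k$-uniform hypergraph, i.e. a finite vertex set $V(\mathcal{H})$ together with a set $E(\mathcal{H})$ of $k$-element subsets of $V(\mathcal{H})$. Call a set of $r$ pairwise disjoint edges an $r$-matching, let $p(\mathcal{H},r)$ be the number of $r$-matchings (so $p(\mathcal{H},0)=1$), and let $$\mu(\mathcal{H},x)=\sum_{r\ge 0}(-1)^r\,p(\mathcal{H},r)\,x^{|V(\mathcal{H})|-kr}$$ be the matching polynomial of $\mathcal{H}$. The degree of a vertex is the number of edges containing it. $\mathcal{H}$ is connected if any two vertices $x,y$ are joined by a path, i.e. a sequence $(v_0,e_1,v_1,\ldots,e_\ell,v_\ell)$, $\ell\ge 0$, of distinct vertices $v_i$ and distinct edges $e_i$ with $v_0=x$, $v_\ell=y$ and $v_{i},v_{i+1}\in e_{i+1}$ for $0\le i<\ell$. The cyclic index of a real polynomial $f$ is the maximum positive integer $\ell$ such that $f(x)=x^t g(x^\ell)$ for some integer $t\ge 0$ and some real polynomial $g$. Theorem. Suppose that $\mathcal{H}$ is connected and that its maximum degree $\Delta$ satisfies $\Delta\ge 2$. Let $\lambda(\mathcal{H})$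 be the maximum modulus of the complex zeros of $\mu(\mathcal{H},x)$. Then the cyclic index of $\mu(\mathcal{H},x)$ is $k$, the number $\lambda(\mathcal{H})$ is a simple root of $\mu(\mathcal{H},x)$, and $$\Delta^{1/k}\le\lambda(\mathcal{H})<\frac{k}{k-1}\bigl((k-1)(\Delta-1)\bigr)^{1/k}.$$ -/

import Mathlib

noncomputable section

namespace Hypergraph

variable {α : Type*}

/-- Every edge has exactly `k` vertices (`Set.ncard` is `0` on infinite sets, so for `k ≠ 0` this
forces the edges to be finite). -/
def IsUniform (H : Hypergraph α) (k : ℕ) : Prop :=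
  ∀ e ∈ H.edgeSet, e.ncard = k

/-- The degree of a vertex: the number of edges containing it. -/
def degree (H : Hypergraph α) (v : α) : ℕ :=
  {e ∈ H.edgeSet | v ∈ e}.ncard

/-- The maximum degree of the vertices of a hypergraph with finitely many vertices. -/
def maxDegree (H : Hypergraph α) : ℕ :=
  sSup (H.degree '' H.vertexSet)

/-- `(v 0, e 0, v 1, e 1, …, e (ℓ - 1), v ℓ)` is a path: an alternating sequence of pairwise
distinct vertices and pairwise distinct edges in which each edge contains the vertices next
to it. -/
def IsPath (H : Hypergraph α) (ℓ : ℕ) (v : Fin (ℓ + 1) → α) (e : Fin ℓ → Set α) : Prop :=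
  (∀ i, v i ∈ H.vertexSet) ∧ (∀ i, e i ∈ H.edgeSet) ∧
    Function.Injective v ∧ Function.Injective e ∧
    ∀ i : Fin ℓ, v i.castSucc ∈ e i ∧ v i.succ ∈ e i

/-- Any two vertices are joined by a path. -/
def IsConnected (H : Hypergraph α) : Prop :=
  ∀ x ∈ H.vertexSet, ∀ y ∈ H.vertexSet,
    ∃ (ℓ : ℕ) (v : Fin (ℓ + 1) → α) (e : Fin ℓ → Set α),
      H.IsPath ℓ v e ∧ v 0 = x ∧ v (Fin.last ℓ) = y

/-- A matching: a set of edges, no two distinct members of which share a vertex. -/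
def IsMatching (H : Hypergraph α) (M : Set (Set α)) : Prop :=
  M ⊆ H.edgeSet ∧ ∀ e ∈ M, ∀ f ∈ M, e ≠ f → Disjoint e f

/-- The number of matchings with exactly `r` edges (of a hypergraph with finitely many vertices). -/
def numMatchings (H : Hypergraph α) (r : ℕ) : ℕ :=
  {M : Set (Set α) | H.IsMatching M ∧ M.ncard = r}.ncard

/-- The matching polynomial `∑ r, (-1)^r p(H, r) x^(|V| - k r)` of a `k`-uniform hypergraph with
finitely many vertices, `k ≥ 1`. An `r`-matching covers `k r` vertices, so there are none with
`r > |V| / k`; the sum runs over `r ≤ |V| / k`, where the exponent is a genuine difference. -/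
def matchingPoly (H : Hypergraph α) (k : ℕ) : Polynomial ℝ :=
  ∑ r ∈ Finset.range (H.vertexSet.ncard / k + 1),
    Polynomial.C ((-1) ^ r * (H.numMatchings r : ℝ)) *
      Polynomial.X ^ (H.vertexSet.ncard - k * r)

end Hypergraph

namespace Polynomial

/-- `f(x) = x^t g(x^ℓ)` for some `t ≥ 0` and some real polynomial `g`. -/
def IsLSymmetric (f : Polynomial ℝ) (ℓ : ℕ) : Prop :=
  ∃ (t : ℕ) (g : Polynomial ℝ), f = X ^ t * g.comp (X ^ ℓ)

/-- `ℓ` is the cyclic index of `f`: the greatest positive integer `ℓ` such that `f` is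
`ℓ`-symmetric. -/
def IsCyclicIndex (f : Polynomial ℝ) (ℓ : ℕ) : Prop :=
  IsGreatest {m : ℕ | 0 < m ∧ f.IsLSymmetric m} ℓ

/-- The maximum modulus of the complex zeros of a nonconstant real polynomial (which has a finite
nonempty set of complex zeros, so that the supremum is a maximum). -/
def maxModulus (f : Polynomial ℝ) : ℝ :=
  sSup {m : ℝ | ∃ z : ℂ, aeval z f = 0 ∧ m = ‖z‖}

end Polynomial

end

/-!
For a vertex set `S` let `P_S(t) = ∑ (-t) ^ |M|` over the matchings `M` inside `S` (`matchSum`).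
The matching polynomial is `x ^ n P_V(x⁻ᵏ)`, so its zeros of largest modulus come from the zeros
of `P_V` of least modulus. Everything rests on the vertex recurrence
`P_S = P_{S - v} - t ∑ P_{S \ e}`, the sum running over the edges `e ⊆ S` through `v`
(`matchSum_eq_sub`).

Let `t₀` be the least nonnegative zero of any of the `P_S` with `S ⊆ V`. On `[0, t₀]` all `P_S` are
nonnegative, so by the recurrence they decrease as `S` grows, and `P_V(t₀) = 0`
(`exists_least_zero`). Connectedness makes `P_S(t₀)` positive for every proper `S`
(`matchSum_pos_of_ssubset`). Hence `P_V'(t₀) = -∑ P_{V \ e}(t₀)` is negative, so `t₀` is a simple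
zero, and the recurrence at a vertex of degree `Δ` gives `t₀ Δ ≤ 1` (`mul_card_le_one`). For
`|z| < t₀` the quotient `|P_S(z)| / P_S(|z|)` increases with `S` from its value `1` at `∅`, so no
complex zero is closer to `0` than `t₀` (`matchSum_complex_ne_zero`).

For the upper bound put `r = (k - 1) / k`, which maximizes `r ^ (k - 1) (1 - r)`. When
`t (Δ - 1) ≤ r ^ (k - 1) (1 - r)`, an induction on proper subsets `S` shows `P_S > r P_{S - v}` for
every vertex `v` of degree less than `Δ` in `S` (`mul_matchSum_erase_lt`); one last step gives
`P_V(t) > 0`, so `t₀` exceeds this range (`matchSum_pos_of_mul_le`).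

The cyclic index is read off the exponents: they are all congruent modulo `k`, and `n` and `n - k`
both occur (`isCyclicIndex_matchingPoly`).
-/

namespace SetSystem

open Finset

variable {α : Type*} [DecidableEq α]

/-! ### Matching sums of a set system and their recurrences -/

/-- The edges of the set system `E` that lie inside `S`. -/
def edgesIn (E : Finset (Finset α)) (S : Finset α) : Finset (Finset α) :=
  E.filter (· ⊆ S)

/-- The matchings of the subsystem induced on `S`: sets of pairwise disjoint edges inside `S`. -/
def matchings (E : Finset (Finset α)) (S : Finset α) : Finset (Finset (Finset α)) :=
  (edgesIn E S).powerset.filter fun M => ∀ e ∈ M, ∀ f ∈ M, e ≠ f → Disjoint e f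

/-- The signed matching generating function `∑ M, (-t) ^ |M|` of the subsystem induced on `S`. -/
def matchSum {R : Type*} [CommRing R] (E : Finset (Finset α)) (S : Finset α) (t : R) : R :=
  ∑ M ∈ matchings E S, (-t) ^ #M

lemma mem_edgesIn {E : Finset (Finset α)} {S e : Finset α} :
    e ∈ edgesIn E S ↔ e ∈ E ∧ e ⊆ S := by
  simp [edgesIn]

lemma mem_matchings {E : Finset (Finset α)} {S : Finset α} {M : Finset (Finset α)} :
    M ∈ matchings E S ↔
      (∀ e ∈ M, e ∈ E ∧ e ⊆ S) ∧ ∀ e ∈ M, ∀ f ∈ M, e ≠ f → Disjoint e f := by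
  simp [matchings, subset_iff, mem_edgesIn]

lemma matchSum_eq_one {R : Type*} [CommRing R] {E : Finset (Finset α)} {S : Finset α}
    (h : ∀ e ∈ E, ¬ e ⊆ S) (t : R) : matchSum E S t = 1 := by
  have : edgesIn E S = ∅ := by
    ext e
    simpa [mem_edgesIn] using h e
  have h2 : matchings E S = {∅} := by
    ext M
    simp only [matchings, this, powerset_empty, mem_filter, mem_singleton]
    constructor
    · exact fun h => h.1
    · rintro rfl
      simp
  simp [matchSum, h2]

/-- Deleting an edge `e` from the matchings through `e` gives the matchings of the subsystem
induced off `e`. -/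
lemma sum_matchings_filter_mem {R : Type*} [CommRing R] {E : Finset (Finset α)}
    {S e : Finset α} (he : e ∈ edgesIn E S) (hne : e.Nonempty) (f : ℕ → R) :
    ∑ M ∈ (matchings E S).filter (e ∈ ·), f #M =
      ∑ M ∈ matchings E (S \ e), f (#M + 1) := by
  have hnot : ∀ M ∈ matchings E (S \ e), e ∉ M := by
    intro M hM heM
    obtain ⟨x, hx⟩ := hne
    exact (mem_sdiff.1 (((mem_matchings.1 hM).1 e heM).2 hx)).2 hx
  rw [mem_edgesIn] at he
  refine sum_bij' (fun M _ => M.erase e) (fun M _ => insert e M) ?_ ?_ ?_ ?_ ?_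
  · intro M hM
    obtain ⟨hM, heM⟩ := mem_filter.1 hM
    obtain ⟨h1, h2⟩ := mem_matchings.1 hM
    refine mem_matchings.2 ⟨fun g hg => ?_, fun g hg g' hg' => ?_⟩
    · obtain ⟨hge, hg⟩ := mem_erase.1 hg
      exact ⟨(h1 g hg).1, subset_sdiff.2 ⟨(h1 g hg).2, h2 g hg e heM hge⟩⟩
    · exact h2 g (mem_of_mem_erase hg) g' (mem_of_mem_erase hg')
  · intro M hM
    obtain ⟨h1, h2⟩ := mem_matchings.1 hM
    refine mem_filter.2 ⟨mem_matchings.2 ⟨fun g hg => ?_, ?_⟩, mem_insert_self _ _⟩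
    · rcases mem_insert.1 hg with rfl | hg
      · exact he
      · exact ⟨(h1 g hg).1, (h1 g hg).2.trans sdiff_subset⟩
    · intro g hg g' hg' hgg
      rcases mem_insert.1 hg with rfl | hgM <;> rcases mem_insert.1 hg' with rfl | hgM'
      · exact absurd rfl hgg
      · exact (subset_sdiff.1 (h1 g' hgM').2).2.symm
      · exact (subset_sdiff.1 (h1 g hgM).2).2
      · exact h2 g hgM g' hgM' hgg
  · intro M hM
    exact insert_erase (mem_filter.1 hM).2
  · intro M hM
    exact erase_insert (hnot M hM)
  · intro M hM
    rw [card_erase_add_one (mem_filter.1 hM).2]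

/-- The recurrence at a vertex `v`: a matching either misses `v` or has exactly one edge
through `v`. -/
lemma matchSum_eq_sub {R : Type*} [CommRing R] {E : Finset (Finset α)} (S : Finset α)
    (hne : ∀ e ∈ E, e.Nonempty) (v : α) (t : R) :
    matchSum E S t = matchSum E (S.erase v) t -
      t * ∑ e ∈ (edgesIn E S).filter (v ∈ ·), matchSum E (S \ e) t := by
  have hsplit := sum_filter_add_sum_filter_not (matchings E S) (fun M => ∃ e ∈ M, v ∈ e)
    (fun M => (-t) ^ #M)
  have hmiss : (matchings E S).filter (fun M => ¬ ∃ e ∈ M, v ∈ e) =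
      matchings E (S.erase v) := by
    ext M
    simp only [mem_filter, mem_matchings, not_exists, not_and, subset_erase]
    grind
  have hcover : (matchings E S).filter (fun M => ∃ e ∈ M, v ∈ e) =
      ((edgesIn E S).filter (v ∈ ·)).biUnion fun e => (matchings E S).filter (e ∈ ·) := by
    ext M
    simp only [mem_filter, mem_biUnion, mem_edgesIn]
    constructor
    · rintro ⟨hM, e, he, hv⟩
      exact ⟨e, ⟨(mem_matchings.1 hM).1 e he, hv⟩, hM, he⟩
    · rintro ⟨e, ⟨_, hv⟩, hM, he⟩
      exact ⟨hM, e, he, hv⟩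
  have hdisj : Set.PairwiseDisjoint (((edgesIn E S).filter (v ∈ ·) : Finset _) : Set (Finset α))
      (fun e => (matchings E S).filter (e ∈ ·)) := by
    intro e he f hf hef
    refine disjoint_left.2 fun M hMe hMf => ?_
    have h := (mem_matchings.1 (mem_filter.1 hMe).1).2 e (mem_filter.1 hMe).2 f
      (mem_filter.1 hMf).2 hef
    exact disjoint_left.1 h (mem_filter.1 he).2 (mem_filter.1 hf).2
  rw [hmiss, hcover, sum_biUnion hdisj] at hsplit
  have hedge : ∀ e ∈ (edgesIn E S).filter (v ∈ ·),
      ∑ M ∈ (matchings E S).filter (e ∈ ·), (-t) ^ #M = -t * matchSum E (S \ e) t := by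
    intro e he
    have he' := (mem_filter.1 he).1
    rw [sum_matchings_filter_mem he' (hne e (mem_edgesIn.1 he').1) (fun n => (-t) ^ n),
      matchSum, mul_sum]
    exact sum_congr rfl fun M _ => pow_succ' _ _
  rw [sum_congr rfl hedge, ← mul_sum] at hsplit
  simp only [matchSum] at hsplit ⊢
  rw [← hsplit]
  ring

lemma matchSum_zero {R : Type*} [CommRing R] {E : Finset (Finset α)} (S : Finset α) :
    matchSum E S (0 : R) = 1 := by
  have h : (∅ : Finset (Finset α)) ∈ matchings E S := mem_matchings.2 (by simp)
  rw [matchSum, sum_eq_single_of_mem ∅ h]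
  · simp
  · intro M _ hM
    simp [hM]

lemma matchSum_empty {R : Type*} [CommRing R] {E : Finset (Finset α)}
    (hne : ∀ e ∈ E, e.Nonempty) (t : R) : matchSum E ∅ t = 1 :=
  matchSum_eq_one (fun e he h => (hne e he).ne_empty (subset_empty.1 h)) t

lemma continuous_matchSum (E : Finset (Finset α)) (S : Finset α) :
    Continuous fun t : ℝ => matchSum E S t := by
  unfold matchSum
  fun_prop

/-- Differentiating `(-t) ^ |M|` marks an edge of `M`, which leaves a matching off that edge. -/
lemma hasDerivAt_matchSum {E : Finset (Finset α)} (S : Finset α)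
    (hne : ∀ e ∈ E, e.Nonempty) (t : ℝ) :
    HasDerivAt (fun t : ℝ => matchSum E S t) (-∑ e ∈ edgesIn E S, matchSum E (S \ e) t) t := by
  have h : HasDerivAt (fun t : ℝ => matchSum E S t)
      (∑ M ∈ matchings E S, (#M : ℝ) * (-t) ^ (#M - 1) * -1) t := by
    unfold matchSum
    exact HasDerivAt.fun_sum fun M _ => (hasDerivAt_neg t).pow _
  convert h using 1
  have hmark : ∀ M ∈ matchings E S, (#M : ℝ) * (-t) ^ (#M - 1) * -1 =
      -∑ e ∈ edgesIn E S, if e ∈ M then (-t) ^ (#M - 1) else 0 := by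
    intro M hM
    rw [← sum_filter, filter_mem_eq_inter, inter_eq_right.2 (fun e he =>
      mem_edgesIn.2 ((mem_matchings.1 hM).1 e he))]
    simp
  rw [sum_congr rfl hmark, sum_neg_distrib, sum_comm]
  congr 1
  refine sum_congr rfl fun e he => ?_
  rw [← sum_filter, sum_matchings_filter_mem he (hne e (mem_edgesIn.1 he).1)
    (fun n => (-t) ^ (n - 1))]
  simp [matchSum]

/-! ### The least zero over all induced subsystems -/

/-- A set function on the subsets of `V` that does not increase when a point is added is
antitone. -/
lemma le_of_le_erase {V : Finset α} {g : Finset α → ℝ}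
    (h : ∀ S ⊆ V, ∀ v ∈ S, g S ≤ g (S.erase v)) {A S : Finset α} (hAS : A ⊆ S) (hS : S ⊆ V) :
    g S ≤ g A := by
  induction S using Finset.strongInduction with
  | H S ih =>
    rcases hAS.eq_or_ssubset with rfl | hlt
    · exact le_rfl
    · obtain ⟨v, hv, hvA⟩ := exists_of_ssubset hlt
      exact (h S hS v hv).trans (ih _ (erase_ssubset hv) (subset_erase.2 ⟨hAS, hvA⟩)
        ((erase_subset _ _).trans hS))

lemma matchSum_anti {E : Finset (Finset α)} {V : Finset α} (hne : ∀ e ∈ E, e.Nonempty) {t : ℝ}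
    (ht : 0 ≤ t) (hpos : ∀ S ⊆ V, 0 ≤ matchSum E S t) {A S : Finset α} (hAS : A ⊆ S)
    (hS : S ⊆ V) : matchSum E S t ≤ matchSum E A t := by
  refine le_of_le_erase (g := fun S => matchSum E S t) (fun S hS v _ => ?_) hAS hS
  rw [matchSum_eq_sub S hne v t, sub_le_self_iff]
  exact mul_nonneg ht (sum_nonneg fun e _ => hpos _ (sdiff_subset.trans hS))

lemma matchSum_edge {E : Finset (Finset α)} {e : Finset α} (hne : ∀ e ∈ E, e.Nonempty)
    (he : e ∈ E) (hmin : ∀ f ∈ E, f ⊆ e → f = e) (t : ℝ) : matchSum E e t = 1 - t := by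
  obtain ⟨v, hv⟩ := hne e he
  rw [matchSum_eq_sub e hne v t]
  have h1 : (edgesIn E e).filter (v ∈ ·) = {e} := by
    ext f
    simp only [mem_filter, mem_edgesIn, mem_singleton]
    constructor
    · exact fun h => hmin f h.1.1 h.1.2
    · rintro rfl
      exact ⟨⟨he, Subset.rfl⟩, hv⟩
  rw [h1, sum_singleton, sdiff_self, bot_eq_empty, matchSum_empty hne,
    matchSum_eq_one, mul_one]
  intro f hf hfe
  have := hmin f hf (hfe.trans (erase_subset _ _))
  subst this
  exact notMem_erase v f (hfe hv)

/-- The least nonnegative zero `t₀` of the matching sums of all induced subsystems is positive,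
and it is a zero of the matching sum of the whole system. -/
lemma exists_least_zero {E : Finset (Finset α)} {V e : Finset α} (hne : ∀ e ∈ E, e.Nonempty)
    (he : e ∈ E) (heV : e ⊆ V) (hmin : ∀ f ∈ E, f ⊆ e → f = e) :
    ∃ t₀ : ℝ, 0 < t₀ ∧ (∀ t, 0 ≤ t → t < t₀ → ∀ S ⊆ V, 0 < matchSum E S t) ∧
      (∀ S ⊆ V, 0 ≤ matchSum E S t₀) ∧ matchSum E V t₀ = 0 := by
  set Z : Set ℝ := ⋃ S ∈ V.powerset, {t : ℝ | 0 ≤ t ∧ matchSum E S t = 0} with hZ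
  have hmem : ∀ t, t ∈ Z ↔ ∃ S ⊆ V, 0 ≤ t ∧ matchSum E S t = 0 := by
    intro t
    simp only [hZ, Set.mem_iUnion, mem_powerset, Set.mem_ofPred_eq, exists_prop]
  have hclosed : IsClosed Z := by
    refine isClosed_biUnion_finset fun S _ => ?_
    exact isClosed_Ici.inter (isClosed_singleton.preimage (continuous_matchSum E S))
  have hnonempty : Z.Nonempty :=
    ⟨1, (hmem 1).2 ⟨e, heV, zero_le_one, by rw [matchSum_edge hne he hmin]; ring⟩⟩
  have hbdd : BddBelow Z := ⟨0, fun t ht => by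
    obtain ⟨S, _, h, _⟩ := (hmem t).1 ht
    exact h⟩
  obtain ⟨S₀, hS₀, h0, hzero⟩ := (hmem _).1 (hclosed.csInf_mem hnonempty hbdd)
  set t₀ := sInf Z
  have ht₀ : 0 < t₀ := by
    refine lt_of_le_of_ne h0 fun h => ?_
    rw [← h, matchSum_zero] at hzero
    exact one_ne_zero hzero
  have hpos : ∀ t, 0 ≤ t → t < t₀ → ∀ S ⊆ V, 0 < matchSum E S t := by
    intro t ht htt S hS
    by_contra! hle
    obtain ⟨u, hu, hu0⟩ := intermediate_value_Icc' ht (continuous_matchSum E S).continuousOn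
      ⟨hle, by rw [matchSum_zero]; exact zero_le_one⟩
    have : t₀ ≤ u := csInf_le hbdd ((hmem u).2 ⟨S, hS, hu.1, hu0⟩)
    linarith [hu.2]
  have hnonneg : ∀ S ⊆ V, 0 ≤ matchSum E S t₀ := by
    intro S hS
    have hlim : Filter.Tendsto (fun t : ℝ => matchSum E S t) (nhdsWithin t₀ (Set.Iio t₀))
        (nhds (matchSum E S t₀)) :=
      ((continuous_matchSum E S).tendsto t₀).mono_left nhdsWithin_le_nhds
    refine ge_of_tendsto hlim ?_
    filter_upwards [Ioo_mem_nhdsLT ht₀] with t ht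
    exact (hpos t ht.1.le ht.2 S hS).le
  refine ⟨t₀, ht₀, hpos, hnonneg, le_antisymm ?_ (hnonneg V Subset.rfl)⟩
  exact (matchSum_anti hne h0 hnonneg hS₀ Subset.rfl).trans hzero.le

/-- Connectedness in cut form: every nonempty proper subset of `V` is crossed by an edge, that
is, some edge has a vertex inside it and a vertex outside it. -/
def IsConn (E : Finset (Finset α)) (V : Finset α) : Prop :=
  ∀ S ⊂ V, S.Nonempty → ∃ e ∈ E, (∃ v ∈ e, v ∈ S) ∧ ∃ u ∈ e, u ∉ S

/-- In a connected system the proper induced subsystems are still positive at `t₀`. Otherwise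
take a minimal `S` whose matching sum vanishes and an edge `e` crossing `S`; the recurrence on
`S ∪ e` at a vertex of `e \ S` gives a negative value. -/
lemma matchSum_pos_of_ssubset {E : Finset (Finset α)} {V : Finset α}
    (hne : ∀ e ∈ E, e.Nonempty) (hEV : ∀ e ∈ E, e ⊆ V) (hconn : IsConn E V) {t : ℝ} (ht : 0 < t)
    (hpos : ∀ S ⊆ V, 0 ≤ matchSum E S t) {S : Finset α} (hS : S ⊂ V) : 0 < matchSum E S t := by
  induction S using Finset.strongInduction with
  | H S ih =>
    rcases S.eq_empty_or_nonempty with rfl | hSne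
    · rw [matchSum_empty hne]
      exact one_pos
    · refine lt_of_le_of_ne (hpos S hS.subset) fun h0 => ?_
      obtain ⟨e, he, ⟨v, hve, hvS⟩, u, hue, huS⟩ := hconn S hS hSne
      have hT : S ∪ e ⊆ V := union_subset hS.subset (hEV e he)
      have hrec := matchSum_eq_sub (S ∪ e) hne u t
      have h1 : matchSum E ((S ∪ e).erase u) t ≤ 0 := by
        rw [h0]
        exact matchSum_anti hne ht.le hpos
          (subset_erase.2 ⟨subset_union_left, huS⟩) ((erase_subset _ _).trans hT)
      have hsub : S \ e ⊂ S :=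
        ⟨sdiff_subset, fun h => (mem_sdiff.1 (h hvS)).2 hve⟩
      have h2 : 0 < matchSum E ((S ∪ e) \ e) t := by
        rw [union_sdiff_right]
        exact ih _ hsub (hsub.trans hS)
      have h3 : matchSum E ((S ∪ e) \ e) t ≤
          ∑ f ∈ (edgesIn E (S ∪ e)).filter (u ∈ ·), matchSum E ((S ∪ e) \ f) t :=
        single_le_sum (f := fun f => matchSum E ((S ∪ e) \ f) t)
          (fun f _ => hpos _ (sdiff_subset.trans hT))
          (mem_filter.2 ⟨mem_edgesIn.2 ⟨he, subset_union_right⟩, hue⟩)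
      have h4 := hpos _ hT
      have h5 := mul_pos ht (h2.trans_le h3)
      linarith

/-- `|P_S(z)| / P_S(|z|)` increases with `S`, by the recurrence and the triangle inequality, and
is `1` at `S = ∅`. So `P_S` has no complex zero in the disc where the real sums are positive. -/
lemma matchSum_complex_ne_zero {E : Finset (Finset α)} {V : Finset α}
    (hne : ∀ e ∈ E, e.Nonempty) {z : ℂ} (hpos : ∀ S ⊆ V, 0 < matchSum E S ‖z‖) :
    matchSum E V z ≠ 0 := by
  have key : ∀ S, S ⊆ V → ∀ A ⊆ S,
      ‖matchSum E A z‖ / matchSum E A ‖z‖ ≤ ‖matchSum E S z‖ / matchSum E S ‖z‖ := by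
    intro S
    induction S using Finset.strongInduction with
    | H S ih =>
      intro hS A hA
      rcases hA.eq_or_ssubset with rfl | hlt
      · exact le_rfl
      · obtain ⟨v, hv, hvA⟩ := exists_of_ssubset hlt
        have hvS : S.erase v ⊆ V := (erase_subset _ _).trans hS
        have ih' := ih _ (erase_ssubset hv) hvS
        refine (ih' A (subset_erase.2 ⟨hA, hvA⟩)).trans ?_
        set q := ‖matchSum E (S.erase v) z‖ / matchSum E (S.erase v) ‖z‖ with hq
        have hqP : ‖matchSum E (S.erase v) z‖ = q * matchSum E (S.erase v) ‖z‖ :=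
          (div_mul_cancel₀ _ (hpos _ hvS).ne').symm
        rw [le_div_iff₀ (hpos S hS), matchSum_eq_sub S hne v ‖z‖, matchSum_eq_sub S hne v z]
        have hsum : ‖z * ∑ e ∈ (edgesIn E S).filter (v ∈ ·), matchSum E (S \ e) z‖ ≤
            ‖z‖ * ∑ e ∈ (edgesIn E S).filter (v ∈ ·), q * matchSum E (S \ e) ‖z‖ := by
          rw [norm_mul]
          refine mul_le_mul_of_nonneg_left (norm_sum_le_of_le _ fun e he => ?_) (norm_nonneg _)
          rw [← div_le_iff₀ (hpos _ (sdiff_subset.trans hS))]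
          exact ih' _ (subset_erase.2 ⟨sdiff_subset, fun h =>
            (mem_sdiff.1 h).2 (mem_filter.1 he).2⟩)
        rw [← mul_sum] at hsum
        have := norm_sub_norm_le (matchSum E (S.erase v) z)
          (z * ∑ e ∈ (edgesIn E S).filter (v ∈ ·), matchSum E (S \ e) z)
        rw [hqP] at this
        linarith
  have h := key V Subset.rfl ∅ (empty_subset _)
  rw [matchSum_empty hne, matchSum_empty hne, norm_one, div_one,
    le_div_iff₀ (hpos V Subset.rfl), one_mul] at h
  exact norm_pos_iff.1 ((hpos V Subset.rfl).trans_le h)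

/-! ### The degree bounds -/

/-- At a vertex `v` of degree `d`, antitonicity turns the recurrence into
`0 ≤ P_V ≤ (1 - t d) P_{V - v}`. -/
lemma mul_card_le_one {E : Finset (Finset α)} {V : Finset α}
    (hne : ∀ e ∈ E, e.Nonempty) (hEV : ∀ e ∈ E, e ⊆ V) {t : ℝ} (ht : 0 ≤ t)
    (hpos : ∀ S ⊆ V, 0 ≤ matchSum E S t) {v : α} (hv : 0 < matchSum E (V.erase v) t) :
    t * #(E.filter (v ∈ ·)) ≤ 1 := by
  have hrec := matchSum_eq_sub V hne v t
  have hE : edgesIn E V = E := filter_true_of_mem hEV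
  have hsum : #(E.filter (v ∈ ·)) * matchSum E (V.erase v) t ≤
      ∑ e ∈ E.filter (v ∈ ·), matchSum E (V \ e) t := by
    rw [← nsmul_eq_mul]
    refine card_nsmul_le_sum _ _ _ fun e he => ?_
    exact matchSum_anti hne ht hpos (subset_erase.2 ⟨sdiff_subset, fun h =>
      (mem_sdiff.1 h).2 (mem_filter.1 he).2⟩) (erase_subset _ _)
  rw [hE] at hrec
  have h1 := hpos V Subset.rfl
  have h2 := mul_le_mul_of_nonneg_left hsum ht
  by_contra! hlt
  nlinarith

lemma pow_card_mul_matchSum_sdiff_lt {E : Finset (Finset α)} {T C : Finset α} {t r : ℝ}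
    (hr : 0 < r) (hC : C.Nonempty) (hCT : C ⊆ T)
    (h : ∀ T' ⊆ T, ∀ u ∈ T', u ∈ C → r * matchSum E (T'.erase u) t < matchSum E T' t) :
    r ^ #C * matchSum E (T \ C) t < matchSum E T t := by
  induction hC using Finset.Nonempty.cons_induction with
  | singleton u =>
    rw [card_singleton, pow_one, sdiff_singleton_eq_erase]
    exact h T Subset.rfl u (hCT (mem_singleton_self u)) (mem_singleton_self u)
  | cons u C hu hC ih =>
    rw [cons_eq_insert] at hCT h ⊢
    have h1 := ih ((subset_insert u C).trans hCT)
      fun T' hT' w hw hwC => h T' hT' w hw (mem_insert_of_mem hwC)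
    have h2 := h (T \ C) sdiff_subset u (mem_sdiff.2 ⟨hCT (mem_insert_self u C), hu⟩)
      (mem_insert_self u C)
    have h3 : T \ insert u C = (T \ C).erase u := by
      ext x
      simp only [mem_sdiff, mem_insert, mem_erase]
      tauto
    rw [card_insert_of_notMem hu, h3, pow_succ, mul_assoc]
    exact (mul_lt_mul_of_pos_left h2 (pow_pos hr _)).trans h1

/-- The edges through a vertex `v` are deleted one vertex at a time: once `v` is gone, the other
vertices of an edge through `v` have lost that edge, so their degree is less than `d`. -/
lemma pow_mul_matchSum_sdiff_lt_erase {E : Finset (Finset α)} {k d : ℕ}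
    (hk : 2 ≤ k) (hcard : ∀ e ∈ E, #e = k) {S e : Finset α} {v : α}
    (hdeg : ∀ v ∈ S, #(E.filter (v ∈ ·)) ≤ d) {t r : ℝ} (hr : 0 < r)
    (he : e ∈ edgesIn E S) (hv : v ∈ e)
    (h : ∀ T ⊆ S.erase v, ∀ u ∈ T, #((edgesIn E T).filter (u ∈ ·)) < d →
      r * matchSum E (T.erase u) t < matchSum E T t) :
    r ^ (k - 1) * matchSum E (S \ e) t < matchSum E (S.erase v) t := by
  obtain ⟨heE, heS⟩ := mem_edgesIn.1 he
  have hC : #(e.erase v) = k - 1 := by rw [card_erase_of_mem hv, hcard e heE]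
  have hsd : S \ e = S.erase v \ e.erase v := by
    ext x
    simp only [mem_sdiff, mem_erase]
    grind
  rw [hsd, ← hC]
  refine pow_card_mul_matchSum_sdiff_lt hr (card_pos.1 (by omega)) (erase_subset_erase v heS)
    fun T hT u hu hue => h T hT u hu ?_
  refine lt_of_lt_of_le (card_lt_card ⟨fun f hf => ?_, fun hsub => ?_⟩)
    (hdeg u (heS (mem_of_mem_erase hue)))
  · rw [mem_filter, mem_edgesIn] at hf
    exact mem_filter.2 ⟨hf.1.1, hf.2⟩
  · have hmem := hsub (mem_filter.2 ⟨heE, mem_of_mem_erase hue⟩)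
    rw [mem_filter, mem_edgesIn] at hmem
    exact notMem_erase v S (hT (hmem.1.2 hv))

/-- The recurrence at `v` when all the quotients `P_{S \ e} / P_{S - v}` are less than `1 / p`. -/
lemma one_sub_mul_matchSum_erase_lt {E : Finset (Finset α)} {S : Finset α} {v : α}
    (hne : ∀ e ∈ E, e.Nonempty) {t c p : ℝ} (ht : 0 < t) (hc : 0 < c) (hp : 0 < p)
    (hS : 0 < matchSum E (S.erase v) t)
    (hcard : t * #((edgesIn E S).filter (v ∈ ·)) ≤ c * p)
    (h : ∀ e ∈ edgesIn E S, v ∈ e → p * matchSum E (S \ e) t < matchSum E (S.erase v) t) :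
    (1 - c) * matchSum E (S.erase v) t < matchSum E S t := by
  have hrec := matchSum_eq_sub S hne v t
  rcases ((edgesIn E S).filter (v ∈ ·)).eq_empty_or_nonempty with h0 | hnon
  · rw [h0, sum_empty] at hrec
    nlinarith
  · have hlt := sum_lt_sum_of_nonempty hnon fun e he =>
      h e (mem_filter.1 he).1 (mem_filter.1 he).2
    rw [sum_const, nsmul_eq_mul, ← mul_sum] at hlt
    have h1 := mul_lt_mul_of_pos_left hlt ht
    have h2 := mul_le_mul_of_nonneg_right hcard hS.le
    refine lt_of_mul_lt_mul_left ?_ hp.le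
    rw [hrec]
    linarith

/-- While `t (d - 1) ≤ (1 - r) r ^ (k - 1)`, deleting a vertex of degree less than `d` from a
proper subset multiplies the matching sum by less than `1 / r`. Connectedness provides such
a vertex in every nonempty proper subset. -/
lemma mul_matchSum_erase_lt {E : Finset (Finset α)} {V : Finset α} {k d : ℕ}
    (hk : 2 ≤ k) (hcard : ∀ e ∈ E, #e = k) (hconn : IsConn E V)
    (hdeg : ∀ v ∈ V, #(E.filter (v ∈ ·)) ≤ d) {t r : ℝ} (ht : 0 < t) (hr : 0 < r)
    (hr1 : r < 1) (htr : t * (d - 1 : ℝ) ≤ (1 - r) * r ^ (k - 1)) {S : Finset α} (hS : S ⊂ V) :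
    0 < matchSum E S t ∧ ∀ v ∈ S, #((edgesIn E S).filter (v ∈ ·)) < d →
      r * matchSum E (S.erase v) t < matchSum E S t := by
  have hne : ∀ e ∈ E, e.Nonempty := fun e he => card_pos.1 (by have := hcard e he; omega)
  induction S using Finset.strongInduction with
  | H S ih =>
    have hratio : ∀ v ∈ S, #((edgesIn E S).filter (v ∈ ·)) < d →
        r * matchSum E (S.erase v) t < matchSum E S t := by
      intro v hv hvd
      have hT := erase_ssubset hv
      have hlt := one_sub_mul_matchSum_erase_lt (S := S) (v := v) hne ht (sub_pos.2 hr1)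
        (pow_pos hr (k - 1)) (ih _ hT (hT.trans hS)).1 ?_ fun e he hve => ?_
      · rwa [sub_sub_cancel] at hlt
      · refine le_trans (mul_le_mul_of_nonneg_left ?_ ht.le) htr
        rw [le_sub_iff_add_le]
        exact_mod_cast hvd
      · refine pow_mul_matchSum_sdiff_lt_erase hk hcard (fun v hv => hdeg v (hS.subset hv)) hr he
          hve fun T hTS u hu hud => ?_
        have hTS' := hTS.trans_ssubset hT
        exact (ih T hTS' (hTS'.trans hS)).2 u hu hud
    refine ⟨?_, hratio⟩
    rcases S.eq_empty_or_nonempty with rfl | hSne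
    · rw [matchSum_empty hne]
      exact one_pos
    · obtain ⟨e, he, ⟨v, hve, hvS⟩, u, hue, huS⟩ := hconn S hS hSne
      have hT := erase_ssubset hvS
      refine lt_trans (mul_pos hr (ih _ hT (hT.trans hS)).1) (hratio v hvS ?_)
      refine lt_of_lt_of_le (card_lt_card ⟨fun f hf => ?_, fun hsub => ?_⟩)
        (hdeg v (hS.subset hvS))
      · rw [mem_filter, mem_edgesIn] at hf
        exact mem_filter.2 ⟨hf.1.1, hf.2⟩
      · have hmem := hsub (mem_filter.2 ⟨he, hve⟩)
        rw [mem_filter, mem_edgesIn] at hmem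
        exact huS (hmem.1.2 hue)

/-- The whole system has no vertex whose degree is known to be less than `d`, but one more use of
the recurrence, at a vertex of degree at most `d`, still gives positivity. -/
lemma matchSum_pos_of_mul_le {E : Finset (Finset α)} {V : Finset α} {k d : ℕ}
    (hk : 2 ≤ k) (hcard : ∀ e ∈ E, #e = k) (hconn : IsConn E V) (hV : V.Nonempty)
    (hdeg : ∀ v ∈ V, #(E.filter (v ∈ ·)) ≤ d) {t r : ℝ} (ht : 0 < t) (hr : 0 < r)
    (hr1 : r < 1) (htr : t * (d - 1 : ℝ) ≤ (1 - r) * r ^ (k - 1))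
    (htop : t * d ≤ r ^ (k - 1)) : 0 < matchSum E V t := by
  have hne : ∀ e ∈ E, e.Nonempty := fun e he => card_pos.1 (by have := hcard e he; omega)
  obtain ⟨v, hv⟩ := hV
  have hT := erase_ssubset hv
  have hlt := one_sub_mul_matchSum_erase_lt (S := V) (v := v) hne ht one_pos
    (pow_pos hr (k - 1)) (mul_matchSum_erase_lt hk hcard hconn hdeg ht hr hr1 htr hT).1 ?_
    fun e he hve => ?_
  · rwa [sub_self, zero_mul] at hlt
  · rw [one_mul]
    refine le_trans (mul_le_mul_of_nonneg_left ?_ ht.le) htop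
    refine Nat.cast_le.2 (le_trans (card_le_card fun f hf => ?_) (hdeg v hv))
    rw [mem_filter, mem_edgesIn] at hf
    exact mem_filter.2 ⟨hf.1.1, hf.2⟩
  · exact pow_mul_matchSum_sdiff_lt_erase hk hcard hdeg hr he hve fun T hTV u hu hud =>
      (mul_matchSum_erase_lt hk hcard hconn hdeg ht hr hr1 htr
        (hTV.trans_ssubset hT)).2 u hu hud

end SetSystem

/-! ### Hypergraphs as finite set systems -/

namespace Hypergraph

open Finset SetSystem

variable {α : Type*}

open scoped Classical in
/-- The edges of `H` inside the finite set `V`, as finite sets. -/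
noncomputable def finEdges (H : Hypergraph α) (V : Finset α) : Finset (Finset α) :=
  V.powerset.filter fun e => (e : Set α) ∈ H.edgeSet

variable {H : Hypergraph α} {V : Finset α} {k : ℕ}

lemma mem_finEdges {e : Finset α} : e ∈ H.finEdges V ↔ e ⊆ V ∧ (e : Set α) ∈ H.edgeSet := by
  simp [finEdges]

lemma mem_finEdges_iff_of_coe_eq (hV : (V : Set α) = H.vertexSet) {e : Finset α} :
    e ∈ H.finEdges V ↔ (e : Set α) ∈ H.edgeSet := by
  rw [mem_finEdges, and_iff_right_iff_imp]
  intro h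
  have := H.subset_vertexSet_of_mem_edgeSet h
  rwa [← hV, coe_subset] at this

lemma exists_finEdges_eq (hV : (V : Set α) = H.vertexSet) {e : Set α} (he : e ∈ H.edgeSet) :
    ∃ f ∈ H.finEdges V, (f : Set α) = e := by
  have hsub := H.subset_vertexSet_of_mem_edgeSet he
  rw [← hV] at hsub
  obtain ⟨f, rfl⟩ := (V.finite_toSet.subset hsub).exists_finset_coe
  exact ⟨f, (mem_finEdges_iff_of_coe_eq hV).2 he, rfl⟩

lemma subset_of_mem_finEdges {e : Finset α} (he : e ∈ H.finEdges V) : e ⊆ V :=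
  (mem_finEdges.1 he).1

lemma IsUniform.card_eq (hunif : H.IsUniform k) {e : Finset α} (he : e ∈ H.finEdges V) :
    #e = k := by
  rw [← Set.ncard_coe_finset]
  exact hunif _ (mem_finEdges.1 he).2

lemma degree_le_maxDegree (hV : (V : Set α) = H.vertexSet) {v : α} (hv : v ∈ V) :
    H.degree v ≤ H.maxDegree := by
  refine le_csSup ?_ ⟨v, hV ▸ mem_coe.2 hv, rfl⟩
  rw [← hV]
  exact (V.finite_toSet.image _).bddAbove

lemma exists_degree_eq_maxDegree (hV : (V : Set α) = H.vertexSet) (hΔ : H.maxDegree ≠ 0) :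
    ∃ v ∈ V, H.degree v = H.maxDegree := by
  have hne : (H.degree '' H.vertexSet).Nonempty := by
    by_contra h
    -- The supremum of the empty set of natural numbers is `0`.
    exact hΔ (by rw [maxDegree, Set.not_nonempty_iff_eq_empty.1 h, csSup_empty]; rfl)
  obtain ⟨v, hv, h⟩ := Nat.sSup_mem hne (by rw [← hV]; exact (V.finite_toSet.image _).bddAbove)
  rw [← hV] at hv
  exact ⟨v, mem_coe.1 hv, h⟩

lemma coeff_matchingPoly (hk : 0 < k) {r : ℕ} (hr : r ≤ H.vertexSet.ncard / k) :
    (H.matchingPoly k).coeff (H.vertexSet.ncard - k * r) = (-1) ^ r * (H.numMatchings r : ℝ) := by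
  have hle : ∀ s, s ≤ H.vertexSet.ncard / k → k * s ≤ H.vertexSet.ncard := fun s hs => by
    rw [mul_comm]
    exact (Nat.le_div_iff_mul_le hk).1 hs
  rw [matchingPoly, Polynomial.finsetSum_coeff, sum_eq_single_of_mem r
    (mem_range.2 (Nat.lt_succ_of_le hr))]
  · rw [Polynomial.coeff_C_mul_X_pow, if_pos rfl]
  · intro s hs hsr
    rw [Polynomial.coeff_C_mul_X_pow, if_neg]
    intro h
    have h1 := hle r hr
    have h2 := hle s (Nat.le_of_lt_succ (mem_range.1 hs))
    exact hsr (Nat.eq_of_mul_eq_mul_left hk (by omega))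

lemma matchingPoly_isLSymmetric (H : Hypergraph α) (k : ℕ) : (H.matchingPoly k).IsLSymmetric k := by
  refine ⟨H.vertexSet.ncard % k, ∑ r ∈ range (H.vertexSet.ncard / k + 1),
    Polynomial.C ((-1) ^ r * (H.numMatchings r : ℝ)) *
      Polynomial.X ^ (H.vertexSet.ncard / k - r), ?_⟩
  rw [matchingPoly, Polynomial.sum_comp, mul_sum]
  refine sum_congr rfl fun r hr => ?_
  have h1 : H.vertexSet.ncard - k * r =
      H.vertexSet.ncard % k + k * (H.vertexSet.ncard / k - r) := by
    have h2 := Nat.mod_add_div H.vertexSet.ncard k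
    have h3 := Nat.mul_le_mul_left k (Nat.le_of_lt_succ (mem_range.1 hr))
    rw [Nat.mul_sub]
    omega
  rw [Polynomial.mul_comp, Polynomial.C_comp, Polynomial.X_pow_comp, h1, pow_add, pow_mul]
  ring

variable [DecidableEq α]

lemma degree_eq_card (hV : (V : Set α) = H.vertexSet) (v : α) :
    H.degree v = #((H.finEdges V).filter (v ∈ ·)) := by
  rw [degree, ← Set.ncard_coe_finset, ← Set.ncard_image_of_injective _ coe_injective]
  congr 1
  ext e
  simp only [Set.mem_image, mem_coe, mem_filter, Set.mem_ofPred_eq]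
  constructor
  · rintro ⟨he, hv⟩
    obtain ⟨f, hf, rfl⟩ := exists_finEdges_eq hV he
    exact ⟨f, ⟨hf, mem_coe.1 hv⟩, rfl⟩
  · rintro ⟨f, ⟨hf, hv⟩, rfl⟩
    exact ⟨(mem_finEdges_iff_of_coe_eq hV).1 hf, mem_coe.2 hv⟩

lemma numMatchings_eq_card (hV : (V : Set α) = H.vertexSet) (r : ℕ) :
    H.numMatchings r = #((matchings (H.finEdges V) V).filter (#· = r)) := by
  have hinj : Function.Injective fun M : Finset (Finset α) =>
      (fun e : Finset α => (e : Set α)) '' (M : Set (Finset α)) :=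
    (Set.image_injective.2 coe_injective).comp coe_injective
  have hncard : ∀ M : Finset (Finset α),
      ((fun e : Finset α => (e : Set α)) '' (M : Set (Finset α))).ncard = #M := fun M => by
    rw [Set.ncard_image_of_injective _ coe_injective, Set.ncard_coe_finset]
  rw [numMatchings, ← Set.ncard_coe_finset, ← Set.ncard_image_of_injective _ hinj]
  congr 1
  ext M
  simp only [Set.mem_image, mem_coe, mem_filter, Set.mem_ofPred_eq]
  constructor
  · rintro ⟨⟨hM, hdisj⟩, hr⟩
    classical
    set N := (H.finEdges V).filter fun e : Finset α => (e : Set α) ∈ M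
    have hNM : (fun e : Finset α => (e : Set α)) '' (N : Set (Finset α)) = M := by
      ext e
      constructor
      · rintro ⟨f, hf, rfl⟩
        exact (mem_filter.1 (mem_coe.1 hf)).2
      · intro he
        obtain ⟨f, hf, rfl⟩ := exists_finEdges_eq hV (hM he)
        exact ⟨f, mem_coe.2 (mem_filter.2 ⟨hf, he⟩), rfl⟩
    refine ⟨N, ⟨mem_matchings.2 ⟨fun e he => ?_, fun e he f hf hef => ?_⟩, ?_⟩, hNM⟩
    · have := (mem_filter.1 he).1
      exact ⟨this, subset_of_mem_finEdges this⟩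
    · exact disjoint_coe.1 (hdisj _ (mem_filter.1 he).2 _ (mem_filter.1 hf).2
        fun h => hef (coe_injective h))
    · rw [← hr, ← hNM, hncard]
  · rintro ⟨N, ⟨hN, hr⟩, rfl⟩
    obtain ⟨h1, h2⟩ := mem_matchings.1 hN
    refine ⟨⟨?_, ?_⟩, (hncard N).trans hr⟩
    · rintro _ ⟨e, he, rfl⟩
      exact (mem_finEdges_iff_of_coe_eq hV).1 (h1 e (mem_coe.1 he)).1
    · rintro _ ⟨e, he, rfl⟩ _ ⟨f, hf, rfl⟩ hef
      exact disjoint_coe.2 (h2 e (mem_coe.1 he) f (mem_coe.1 hf) fun h => hef (h ▸ rfl))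

lemma card_le_of_mem_matchings (hk : 0 < k) (hunif : H.IsUniform k) {M : Finset (Finset α)}
    (hM : M ∈ matchings (H.finEdges V) V) : #M ≤ #V / k := by
  obtain ⟨h1, h2⟩ := mem_matchings.1 hM
  rw [Nat.le_div_iff_mul_le hk]
  have hdisj : Set.PairwiseDisjoint (M : Set (Finset α)) id := fun e he f hf hef =>
    h2 e (mem_coe.1 he) f (mem_coe.1 hf) hef
  calc #M * k = ∑ e ∈ M, #e := by
        rw [sum_congr rfl fun e he => hunif.card_eq (h1 e he).1, sum_const, smul_eq_mul]
    _ = #(M.biUnion id) := (card_biUnion fun e he f hf hef => h2 e he f hf hef).symm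
    _ ≤ #V := card_le_card (biUnion_subset.2 fun e he => (h1 e he).2)

/-- The substitution `t = x⁻ᵏ` turns the matching polynomial into the matching sum. -/
lemma aeval_matchingPoly {K : Type*} [Field K] [Algebra ℝ K] (hk : 0 < k)
    (hV : (V : Set α) = H.vertexSet) (hunif : H.IsUniform k) {x : K} (hx : x ≠ 0) :
    Polynomial.aeval x (H.matchingPoly k) =
      x ^ #V * matchSum (H.finEdges V) V (x ^ k)⁻¹ := by
  have hn : H.vertexSet.ncard = #V := by rw [← hV, Set.ncard_coe_finset]
  have hmaps : ∀ M ∈ matchings (H.finEdges V) V, #M ∈ range (#V / k + 1) := fun M hM =>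
    mem_range.2 (Nat.lt_succ_of_le (card_le_of_mem_matchings hk hunif hM))
  rw [matchSum, ← sum_fiberwise_of_maps_to hmaps, matchingPoly, hn, map_sum, mul_sum]
  refine sum_congr rfl fun r hr => ?_
  have hr' : k * r ≤ #V := by
    rw [mul_comm]
    exact (Nat.le_div_iff_mul_le hk).1 (Nat.le_of_lt_succ (mem_range.1 hr))
  rw [sum_congr rfl fun M hM => by rw [(mem_filter.1 hM).2], sum_const,
    ← numMatchings_eq_card hV, nsmul_eq_mul]
  simp only [map_mul, map_pow, map_neg, map_one, Polynomial.aeval_X,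
    map_natCast]
  rw [pow_sub₀ x hx hr', pow_mul, neg_pow ((x ^ k)⁻¹), inv_pow]
  ring

/-- A path that leaves `S` has a step that leaves `S`, along an edge that crosses it. -/
lemma isConn_finEdges (hV : (V : Set α) = H.vertexSet) (hconn : H.IsConnected) :
    IsConn (H.finEdges V) V := by
  intro S hS ⟨x, hx⟩
  obtain ⟨y, hyV, hyS⟩ := exists_of_ssubset hS
  by_contra! hno
  have hmemV : ∀ z ∈ V, z ∈ H.vertexSet := fun z hz => hV ▸ mem_coe.2 hz
  obtain ⟨ℓ, v, e, ⟨_, he, _, _, hve⟩, h0, hlast⟩ :=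
    hconn x (hmemV x (hS.subset hx)) y (hmemV y hyV)
  have hall : ∀ i, v i ∈ S := by
    intro i
    induction i using Fin.induction with
    | zero => rwa [h0]
    | succ i ih =>
      obtain ⟨f, hf, hfe⟩ := exists_finEdges_eq hV (he i)
      have h := hve i
      rw [← hfe] at h
      exact hno f hf ⟨_, mem_coe.1 h.1, ih⟩ _ (mem_coe.1 h.2)
  exact hyS (hlast ▸ hall _)

/-! ### The cyclic index -/

lemma numMatchings_zero (hV : (V : Set α) = H.vertexSet) : H.numMatchings 0 = 1 := by
  rw [numMatchings_eq_card hV, card_eq_one]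
  refine ⟨∅, ?_⟩
  ext M
  simp only [mem_filter, card_eq_zero, mem_singleton, and_iff_right_iff_imp]
  rintro rfl
  exact mem_matchings.2 (by simp)

lemma numMatchings_one_ne_zero (hV : (V : Set α) = H.vertexSet) {e : Finset α}
    (he : e ∈ H.finEdges V) : H.numMatchings 1 ≠ 0 := by
  rw [numMatchings_eq_card hV, card_ne_zero]
  refine ⟨{e}, mem_filter.2 ⟨mem_matchings.2 ⟨?_, ?_⟩, card_singleton e⟩⟩
  · simpa using ⟨he, subset_of_mem_finEdges he⟩
  · simp +contextual

/-- As soon as there is an edge, `x ^ n` and `x ^ (n - k)` both occur in the matching polynomial,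
so an `ℓ`-symmetry forces `ℓ ∣ k`. -/
lemma isCyclicIndex_matchingPoly (hk : 0 < k) (hV : (V : Set α) = H.vertexSet)
    (hunif : H.IsUniform k) {e : Finset α} (he : e ∈ H.finEdges V) :
    (H.matchingPoly k).IsCyclicIndex k := by
  refine ⟨⟨hk, matchingPoly_isLSymmetric H k⟩, ?_⟩
  rintro l ⟨hl, t, g, hg⟩
  have hdvd : ∀ j, (H.matchingPoly k).coeff j ≠ 0 → t ≤ j ∧ l ∣ j - t := by
    intro j hj
    rw [hg, ← Polynomial.expand_eq_comp_X_pow, Polynomial.coeff_X_pow_mul',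
      Polynomial.coeff_expand hl] at hj
    split_ifs at hj with h1 h2
    · exact ⟨h1, h2⟩
    · exact absurd rfl hj
    · exact absurd rfl hj
  have hn : k ≤ H.vertexSet.ncard := by
    rw [← hV, Set.ncard_coe_finset, ← hunif.card_eq he]
    exact card_le_card (subset_of_mem_finEdges he)
  have h0 := coeff_matchingPoly (H := H) hk (r := 0) (Nat.zero_le _)
  have h1 := coeff_matchingPoly (H := H) hk (r := 1) ((Nat.one_le_div_iff hk).2 hn)
  obtain ⟨ht0, hd0⟩ := hdvd _ (by rw [h0, numMatchings_zero hV]; norm_num)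
  obtain ⟨ht1, hd1⟩ := hdvd _ (by
    rw [h1]
    exact mul_ne_zero (by norm_num) (Nat.cast_ne_zero.2 (numMatchings_one_ne_zero hV he)))
  refine Nat.le_of_dvd hk ?_
  have := Nat.dvd_sub hd0 hd1
  convert this using 1
  omega

/-! ### The largest modulus of a zero -/

/-- If `l⁻ᵏ` is a zero of the matching sum of least modulus among the complex ones, then `l` is
the largest modulus of a zero of the matching polynomial. -/
lemma maxModulus_matchingPoly (hk : 0 < k) (hV : (V : Set α) = H.vertexSet)
    (hunif : H.IsUniform k) {l : ℝ} (hl : 0 < l)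
    (hzero : matchSum (H.finEdges V) V (l ^ k)⁻¹ = 0)
    (hmin : ∀ z : ℂ, ‖z‖ < (l ^ k)⁻¹ → matchSum (H.finEdges V) V z ≠ 0) :
    (H.matchingPoly k).maxModulus = l := by
  refine IsGreatest.csSup_eq ⟨⟨(l : ℂ), ?_, ?_⟩, ?_⟩
  · have h := aeval_matchingPoly hk hV hunif hl.ne'
    rw [hzero, mul_zero] at h
    have h2 := Polynomial.aeval_algebraMap_apply ℂ l (H.matchingPoly k)
    rw [h, map_zero] at h2
    exact h2
  · rw [Complex.norm_real, Real.norm_of_nonneg hl.le]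
  · rintro _ ⟨z, hz, rfl⟩
    by_contra! hlt
    have hz0 : z ≠ 0 := norm_pos_iff.1 (hl.trans hlt)
    rw [aeval_matchingPoly hk hV hunif hz0] at hz
    refine hmin _ ?_ ((mul_eq_zero.1 hz).resolve_left (pow_ne_zero _ hz0))
    rw [norm_inv, norm_pow]
    exact inv_strictAnti₀ (pow_pos hl k) (pow_lt_pow_left₀ hlt hl.le hk.ne')

/-- Away from `0` the substitution `t = x⁻ᵏ` is a local diffeomorphism, so it preserves simple
zeros. -/
lemma rootMultiplicity_matchingPoly (hk : 0 < k) (hV : (V : Set α) = H.vertexSet)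
    (hunif : H.IsUniform k) {l d : ℝ} (hl : 0 < l)
    (hzero : matchSum (H.finEdges V) V (l ^ k)⁻¹ = 0)
    (hd : HasDerivAt (fun t : ℝ => matchSum (H.finEdges V) V t) d (l ^ k)⁻¹) (hd0 : d ≠ 0) :
    (H.matchingPoly k).rootMultiplicity l = 1 := by
  have heval : ∀ x : ℝ, x ≠ 0 → (H.matchingPoly k).eval x =
      x ^ #V * matchSum (H.finEdges V) V (x ^ k)⁻¹ := fun x hx => by
    rw [← aeval_matchingPoly hk hV hunif hx, Polynomial.coe_aeval_eq_eval]
  have hroot : (H.matchingPoly k).IsRoot l := by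
    rw [Polynomial.IsRoot, heval l hl.ne', hzero, mul_zero]
  have hinv : HasDerivAt (fun x : ℝ => (x ^ k)⁻¹) (-(k * l ^ (k - 1)) / (l ^ k) ^ 2) l :=
    (hasDerivAt_pow k l).fun_inv (pow_ne_zero k hl.ne')
  have hprod := (hasDerivAt_pow #V l).fun_mul (hd.comp l hinv)
  have hmu := (H.matchingPoly k).hasDerivAt l
  have heq : (fun x => (H.matchingPoly k).eval x) =ᶠ[nhds l]
      fun x => x ^ #V * matchSum (H.finEdges V) V (x ^ k)⁻¹ := by
    filter_upwards [isOpen_ne.mem_nhds hl.ne'] with x hx using heval x hx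
  have hder := hmu.unique (hprod.congr_of_eventuallyEq heq)
  have hderiv : ¬ (H.matchingPoly k).derivative.IsRoot l := by
    rw [Polynomial.IsRoot, hder]
    simp only [Function.comp_apply, hzero, mul_zero, zero_add]
    have hk' : (k : ℝ) ≠ 0 := Nat.cast_ne_zero.2 hk.ne'
    have hl' := hl.ne'
    exact mul_ne_zero (pow_ne_zero _ hl') (mul_ne_zero hd0 (div_ne_zero
      (neg_ne_zero.2 (mul_ne_zero hk' (pow_ne_zero _ hl'))) (pow_ne_zero _ (pow_ne_zero _ hl'))))
  have hne : H.matchingPoly k ≠ 0 := by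
    intro h
    rw [h, Polynomial.derivative_zero] at hderiv
    exact hderiv Polynomial.eval_zero
  have hpos := (Polynomial.rootMultiplicity_pos hne).2 hroot
  have hle := mt (Polynomial.one_lt_rootMultiplicity_iff_isRoot hne).1 fun h => hderiv h.2
  omega

end Hypergraph

/-! ### Zeros of the matching polynomial of a connected hypergraph -/

open Finset SetSystem Hypergraph in
theorem theorem1p4 {α : Type*} (H : Hypergraph α) (k : ℕ) (hk : 2 ≤ k)
    (hfin : H.vertexSet.Finite) (hunif : H.IsUniform k) (hconn : H.IsConnected)
    (hΔ : 2 ≤ H.maxDegree) :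
    (H.matchingPoly k).IsCyclicIndex k ∧
    (H.matchingPoly k).rootMultiplicity (H.matchingPoly k).maxModulus = 1 ∧
    (H.maxDegree : ℝ) ^ (1 / (k : ℝ)) ≤ (H.matchingPoly k).maxModulus ∧
    (H.matchingPoly k).maxModulus <
      ((k : ℝ) / ((k : ℝ) - 1)) *
        (((k : ℝ) - 1) * ((H.maxDegree : ℝ) - 1)) ^ (1 / (k : ℝ)) := by
  classical
  obtain ⟨V, hV⟩ := hfin.exists_finset_coe
  have hk0 : 0 < k := by omega
  set E := H.finEdges V with hE
  have hcard : ∀ e ∈ E, #e = k := fun e he => hunif.card_eq he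
  have hEV : ∀ e ∈ E, e ⊆ V := fun e he => subset_of_mem_finEdges he
  have hne : ∀ e ∈ E, e.Nonempty := fun e he => card_pos.1 (by rw [hcard e he]; exact hk0)
  have hc := isConn_finEdges hV hconn
  have hdeg : ∀ v ∈ V, #(E.filter (v ∈ ·)) ≤ H.maxDegree := fun v hv => by
    rw [← degree_eq_card hV]
    exact degree_le_maxDegree hV hv
  obtain ⟨v, hv, hvΔ⟩ := exists_degree_eq_maxDegree hV (by omega)
  rw [degree_eq_card hV, ← hE] at hvΔ
  obtain ⟨e, he⟩ : E.Nonempty := by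
    obtain ⟨e, he⟩ := card_pos.1 (show 0 < #(E.filter (v ∈ ·)) by omega)
    exact ⟨e, (mem_filter.1 he).1⟩
  obtain ⟨t₀, ht₀, hpos, hnonneg, hzero⟩ := exists_least_zero hne he (hEV e he) fun f hf hfe =>
    eq_of_subset_of_card_le hfe (by rw [hcard e he, hcard f hf])
  have hproper : ∀ S ⊂ V, 0 < matchSum E S t₀ := fun S hS =>
    matchSum_pos_of_ssubset hne hEV hc ht₀ hnonneg hS
  obtain ⟨l, hl, hlt⟩ : ∃ l : ℝ, 0 < l ∧ (l ^ k)⁻¹ = t₀ :=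
    ⟨(t₀⁻¹) ^ ((k : ℝ)⁻¹), by positivity, by
      rw [Real.rpow_inv_natCast_pow (inv_nonneg.2 ht₀.le) hk0.ne', inv_inv]⟩
  have hlk : l ^ k = t₀⁻¹ := by rw [← hlt, inv_inv]
  have hmax : (H.matchingPoly k).maxModulus = l :=
    maxModulus_matchingPoly hk0 hV hunif hl (by rw [hlt]; exact hzero) fun z hz =>
      matchSum_complex_ne_zero hne (hpos _ (norm_nonneg z) (hlt ▸ hz))
  rw [hmax]
  refine ⟨isCyclicIndex_matchingPoly hk0 hV hunif he, ?_, ?_, ?_⟩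
  · refine rootMultiplicity_matchingPoly hk0 hV hunif hl (by rw [hlt]; exact hzero)
      (by rw [hlt]; exact hasDerivAt_matchSum V hne t₀) (neg_ne_zero.2 (ne_of_gt ?_))
    refine sum_pos (fun f hf => hproper _ ?_) ⟨e, mem_edgesIn.2 ⟨he, hEV e he⟩⟩
    obtain ⟨hfE, hfV⟩ := mem_edgesIn.1 hf
    exact sdiff_ssubset hfV (hne f hfE)
  · have hbound := mul_card_le_one hne hEV ht₀.le hnonneg (hproper _ (erase_ssubset hv))
    rw [hvΔ] at hbound
    have hle : (H.maxDegree : ℝ) ≤ l ^ k := by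
      rw [hlk, ← one_div, le_div_iff₀ ht₀, mul_comm]
      exact hbound
    rw [one_div, ← Real.pow_rpow_inv_natCast hl.le hk0.ne']
    exact Real.rpow_le_rpow (Nat.cast_nonneg _) hle (by positivity)
  · have hk2 : (2 : ℝ) ≤ k := by exact_mod_cast hk
    have hd2 : (2 : ℝ) ≤ H.maxDegree := by exact_mod_cast hΔ
    set d : ℝ := (H.maxDegree : ℝ)
    -- `r = (k - 1) / k` maximizes `(1 - r) r ^ (k - 1)`.
    set r : ℝ := ((k : ℝ) - 1) / k with hr
    have hk1 : 0 < (k : ℝ) - 1 := by linarith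
    have hkpos : 0 < (k : ℝ) := by linarith
    have hd1 : 0 < d - 1 := by linarith
    have hrpos : 0 < r := div_pos hk1 hkpos
    have h1r : 1 - r = 1 / k := by
      rw [hr]
      field_simp
      ring
    have hlt_t : (1 - r) * r ^ (k - 1) / (d - 1) < t₀ := by
      by_contra! hle
      rw [le_div_iff₀ hd1] at hle
      refine (matchSum_pos_of_mul_le hk hcard hc ⟨v, hv⟩ hdeg ht₀ hrpos ?_ hle ?_).ne' hzero
      · have : 0 < 1 / (k : ℝ) := by positivity
        linarith
      · -- `d ≤ k (d - 1)`, with equality for `k = d = 2`.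
        rw [h1r, one_div, inv_mul_eq_div, le_div_iff₀ hkpos] at hle
        refine le_trans ?_ hle
        have : d ≤ (d - 1) * k := by nlinarith
        calc t₀ * d ≤ t₀ * ((d - 1) * k) := mul_le_mul_of_nonneg_left this ht₀.le
          _ = t₀ * (d - 1) * k := by ring
    refine lt_of_pow_lt_pow_left₀ k (by positivity) ?_
    rw [mul_pow, one_div, Real.rpow_inv_natCast_pow (by positivity) hk0.ne', hlk,
      inv_lt_comm₀ ht₀ (by positivity)]
    refine lt_of_eq_of_lt ?_ hlt_t
    have hrk : (k : ℝ) / (k - 1) = r⁻¹ := by rw [hr, inv_div]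
    have hpow : r ^ k = r ^ (k - 1) * r := by rw [← pow_succ, Nat.sub_add_cancel hk0]
    have hkr : (k : ℝ) - 1 = k * r := by
      rw [hr]
      field_simp
    rw [hrk, inv_pow, hpow, h1r, hkr]
    field_simp
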